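/- For a real number $\lambda>1$, the logarithmic lattice with spacing factor $\lambda$ is $\Lambda=\{\pm\lambda^n : n\in\mathbb Z\}$. Three points $k,p,q\in\Lambda$ form a triad if $k=p+q$; then $k$ is said to interact with $p$ and with $q$. The lattice is nondegenerate if every two of its nodes are joined by a finite sequence of such interactions. The triads at unity are the ordered pairs $(p,q)\in\Lambda\times\Lambda$ with $1=p+q$. Let $$\sigma=\frac{\sqrt[3]{9+\sqrt{69}}+\sqrt[3]{9-\sqrt{69}}}{\sqrt[3]{18}}\approx 1.325$$ be the plastic number. **Theorem.** A logarithmic lattice with spacing factor $\lambda\ge 1.05$ is nondegenerate if and only if one of the following holds: (i) $\lambda=2$. In this case there are exactly three triads at unity: $(2,-1)$, $(-1,2)$, $(\tfrac12,\tfrac12)$. (ii) $\lambda=\sigma$. In this case there are exactly twelve triads at unity: $(\sigma^3,-\sigma)$, $(\sigma^2,-\sigma^{-1})$, $(\sigma^{-3},\sigma^{-2})$, $(\sigma^5,-\sigma^4)$, $(\sigma,-\sigma^{-4})$, $(\sigma^{-5},\sigma^{-1})$, and the same six pairs with their entries exchanged. (iii) $1=\lambda^b-\lambda^a$ for some coprime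 integers $1\le a<b\le 62$ with $(a,b)\ne(1,3)$ and $(a,b)\neq(4,5)$. In this case, for any such $(a,b)$, there are exactly six triads at unity: $(\lambda^b,-\lambda^a)$, $(\lambda^{b-a},-\lambda^{-a})$, $(\lambda^{-b},\lambda^{a-b})$, and the same three pairs with their entries exchanged. Moreover, let $0\le a_1<b_1$, $0\le a_2<b_2$ be integers with $a_1<a_2$, and let $\lambda\ge1.05$. Then $\lambda$ is a common root of $x^{b_1}-x^{a_1}-1$ and $x^{b_2}-x^{a_2}-1$ if and only if, for some $m\in\{1,2,3,4,5\}$, $\lambda=\sigma^{1/m}$, $(a_1,b_1)=(m,3m)$ and $(a_2,b_2)=(4m,5m)$. -/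

import Mathlib

namespace LogLattice

/-- The logarithmic lattice `{± lam ^ n : n ∈ ℤ}` with spacing factor `lam`. -/
def lattice (lam : ℝ) : Set ℝ :=
  {k | ∃ n : ℤ, k = lam ^ n ∨ k = -lam ^ n}

/-- Three lattice points `k, p, q` form a triad if `k = p + q`. -/
def IsTriad (lam k p q : ℝ) : Prop :=
  k ∈ lattice lam ∧ p ∈ lattice lam ∧ q ∈ lattice lam ∧ k = p + q

/-- `k` interacts with `p` if `k, p` are part of a triad `k = p + q`.
(By commutativity of addition, `k` then also interacts with `q`; the relation is symmetric
because the lattice is symmetric under `q ↦ -q`.) -/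
def Interacts (lam k p : ℝ) : Prop :=
  ∃ q : ℝ, IsTriad lam k p q

/-- The lattice is nondegenerate if every two nodes interact through a finite sequence
of triads. -/
def Nondegenerate (lam : ℝ) : Prop :=
  ∀ k ∈ lattice lam, ∀ p ∈ lattice lam, Relation.ReflTransGen (Interacts lam) k p

/-- The triads at unity: all `(p, q)` with `p, q` in the lattice and `1 = p + q`. -/
def triadsAtUnity (lam : ℝ) : Set (ℝ × ℝ) :=
  {pq | IsTriad lam 1 pq.1 pq.2}

/-- The plastic number. -/
noncomputable def plastic : ℝ :=
  ((9 + √69) ^ (1 / 3 : ℝ) + (9 - √69) ^ (1 / 3 : ℝ)) / (18 : ℝ) ^ (1 / 3 : ℝ)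

/-- The table of triads at unity for spacing factor `2`. -/
def tableTwo : Set (ℝ × ℝ) :=
  {(2, -1), (-1, 2), (1 / 2, 1 / 2)}

/-- The table of triads at unity for a spacing factor with `1 = lam ^ b - lam ^ a`. -/
def tableGeneral (lam : ℝ) (a b : ℤ) : Set (ℝ × ℝ) :=
  {(lam ^ b, -lam ^ a), (-lam ^ a, lam ^ b),
   (lam ^ (b - a), -lam ^ (-a)), (-lam ^ (-a), lam ^ (b - a)),
   (lam ^ (-b), lam ^ (a - b)), (lam ^ (a - b), lam ^ (-b))}

/-- The table of triads at unity for the plastic number `s`. -/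
def tableExtended (s : ℝ) : Set (ℝ × ℝ) :=
  {(s ^ 3, -s), (-s, s ^ 3),
   (s ^ 2, -s ^ (-1 : ℤ)), (-s ^ (-1 : ℤ), s ^ 2),
   (s ^ (-3 : ℤ), s ^ (-2 : ℤ)), (s ^ (-2 : ℤ), s ^ (-3 : ℤ)),
   (s ^ 5, -s ^ 4), (-s ^ 4, s ^ 5),
   (s, -s ^ (-4 : ℤ)), (-s ^ (-4 : ℤ), s),
   (s ^ (-5 : ℤ), s ^ (-1 : ℤ)), (s ^ (-1 : ℤ), s ^ (-5 : ℤ))}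

/-- `lam` is a root of the trinomial `1 = lam ^ b - lam ^ a`. -/
def IsTrinomialRoot (lam : ℝ) (a b : ℕ) : Prop :=
  1 = lam ^ b - lam ^ a

/-- The exponent pairs of the generic case: coprime `1 ≤ a < b ≤ 62` other than
`(1, 3)` and `(4, 5)`. The remaining coprime pair with `0 = a < b` is `(0, 1)`, i.e. `lam = 2`. -/
def GenericPair (a b : ℕ) : Prop :=
  1 ≤ a ∧ a < b ∧ b ≤ 62 ∧ Nat.Coprime a b ∧ (a, b) ≠ (1, 3) ∧ (a, b) ≠ (4, 5)

end LogLattice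

namespace LogLattice

/-! ### Separation of the roots of trinomials by dyadic bisection -/

/-- Whether `x ^ b - x ^ a - 1` is positive at `x = N / D`. -/
def posAt (N D : ℕ) (p : ℕ × ℕ) : Bool :=
  Nat.blt (N ^ p.1 * D ^ (p.2 - p.1) + D ^ p.2) (N ^ p.2)

/-- Whether `p` and `q` are the exponents of `x ^ (3 m) - x ^ m - 1` and
`x ^ (5 m) - x ^ (4 m) - 1`, which are both divisible by `x ^ (3 m) - x ^ m - 1`. -/
def isPlasticPair (p q : ℕ × ℕ) : Bool :=
  Nat.beq p.2 (3 * p.1) && Nat.beq q.1 (4 * p.1) && Nat.beq q.2 (5 * p.1)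

/-- Whether a list has at most one entry, or two entries forming a plastic pair. -/
def isLeaf : List (ℕ × ℕ) → Bool
  | [] => true
  | [_] => true
  | [p, q] => isPlasticPair p q || isPlasticPair q p
  | _ => false

/-- Splits the list of trinomials by the sign at `N / D`, then bisects further, and checks that
the lists shrink to leaves before the fuel runs out. -/
def separates : ℕ → ℕ → ℕ → List (ℕ × ℕ) → Bool
  | 0, _, _, l => isLeaf l
  | k + 1, N, D, l => isLeaf l ||
      (separates k (2 * N - 1) (2 * D) (l.filter (posAt N D)) &&
        separates k (2 * N + 1) (2 * D) (l.filter fun p => !posAt N D p))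

/-- The exponent pairs `a < b < n`. -/
def exponentPairs (n : ℕ) : List (ℕ × ℕ) :=
  (List.range n).flatMap fun b => (List.range b).map fun a => (a, b)

theorem mem_exponentPairs {n a b : ℕ} : (a, b) ∈ exponentPairs n ↔ a < b ∧ b < n := by
  simp only [exponentPairs, List.mem_flatMap, List.mem_range, List.mem_map, Prod.mk.injEq]
  constructor
  · rintro ⟨x, hx, y, hy, rfl, rfl⟩
    exact ⟨hy, hx⟩
  · rintro ⟨h, h'⟩
    exact ⟨b, h', a, h, rfl, rfl⟩

theorem separates_exponentPairs :
    separates 20 3 2 ((exponentPairs 63).filter fun p => !posAt 21 20 p) = true := by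
  decide +kernel

theorem pow_sub_pow_le {x y : ℝ} (hx : 1 ≤ x) (hxy : x ≤ y) {a b : ℕ} (hab : a ≤ b) :
    x ^ b - x ^ a ≤ y ^ b - y ^ a := by
  obtain ⟨c, rfl⟩ := Nat.exists_eq_add_of_le hab
  have h1 : x ^ a ≤ y ^ a := by gcongr
  have h2 : x ^ c ≤ y ^ c := by gcongr
  have h3 : 1 ≤ x ^ c := one_le_pow₀ hx
  have h4 : 0 ≤ y ^ a := pow_nonneg (by linarith) a
  calc x ^ (a + c) - x ^ a = x ^ a * (x ^ c - 1) := by ring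
    _ ≤ y ^ a * (y ^ c - 1) := by gcongr
    _ = _ := by ring

theorem pow_sub_pow_lt {x y : ℝ} (hx : 1 ≤ x) (hxy : x < y) {a b : ℕ} (hab : a < b) :
    x ^ b - x ^ a < y ^ b - y ^ a := by
  obtain ⟨c, hc, rfl⟩ := Nat.exists_eq_add_of_lt hab |>.imp fun c hc =>
    (show 0 < c + 1 ∧ b = a + (c + 1) from ⟨by omega, by omega⟩)
  have h1 : x ^ a ≤ y ^ a := by gcongr
  have h2 : x ^ (c + 1) < y ^ (c + 1) := by gcongr
  have h3 : 1 ≤ x ^ (c + 1) := one_le_pow₀ hx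
  have h4 : 0 < y ^ a := pow_pos (by linarith) a
  calc x ^ (a + (c + 1)) - x ^ a = x ^ a * (x ^ (c + 1) - 1) := by ring
    _ ≤ y ^ a * (x ^ (c + 1) - 1) := by gcongr
    _ < y ^ a * (y ^ (c + 1) - 1) := by gcongr
    _ = _ := by ring

theorem IsTrinomialRoot.unique {x y : ℝ} (hx : 1 ≤ x) (hy : 1 ≤ y) {a b : ℕ} (hab : a < b)
    (h : IsTrinomialRoot x a b) (h' : IsTrinomialRoot y a b) : x = y := by
  unfold IsTrinomialRoot at h h'
  rcases lt_trichotomy x y with hxy | hxy | hxy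
  · linarith [pow_sub_pow_lt hx hxy hab]
  · exact hxy
  · linarith [pow_sub_pow_lt hy hxy hab]

theorem posAt_iff {N D a b : ℕ} (hD : 0 < D) (hab : a ≤ b) :
    posAt N D (a, b) = true ↔ 1 < ((N : ℝ) / D) ^ b - ((N : ℝ) / D) ^ a := by
  obtain ⟨c, rfl⟩ := Nat.exists_eq_add_of_le hab
  have e : ((N : ℝ) / D) ^ (a + c) - ((N : ℝ) / D) ^ a - 1 =
      ((N : ℝ) ^ (a + c) - ((N : ℝ) ^ a * D ^ c + D ^ (a + c))) / D ^ (a + c) := by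
    have : (D : ℝ) ≠ 0 := by positivity
    rw [div_pow, div_pow, pow_add (D : ℝ)]
    field_simp
    ring
  rw [← sub_pos, e, div_pos_iff_of_pos_right (by positivity), sub_pos, posAt, Nat.blt_eq]
  simp only [Nat.add_sub_cancel_left]
  exact_mod_cast Iff.rfl

theorem IsTrinomialRoot.posAt_iff_lt {lam : ℝ} (hlam : 1 ≤ lam) {a b : ℕ} (hab : a < b)
    (h : IsTrinomialRoot lam a b) {N D : ℕ} (hD : 0 < D) (hN : D ≤ N) :
    posAt N D (a, b) = true ↔ lam < (N : ℝ) / D := by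
  have hN' : 1 ≤ (N : ℝ) / D := by
    rw [one_le_div (by positivity)]
    exact_mod_cast hN
  rw [posAt_iff hD hab.le]
  unfold IsTrinomialRoot at h
  constructor
  · intro h1
    by_contra! h2
    linarith [pow_sub_pow_le hN' h2 hab.le]
  · intro h1
    linarith [pow_sub_pow_lt hlam h1 hab]

theorem isPlasticPair_of_isLeaf {l : List (ℕ × ℕ)} (hl : isLeaf l = true) {p q : ℕ × ℕ}
    (hp : p ∈ l) (hq : q ∈ l) (hpq : p ≠ q) :
    isPlasticPair p q = true ∨ isPlasticPair q p = true := by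
  match l, hl with
  | [], _ => simp at hp
  | [x], _ =>
    simp only [List.mem_singleton] at hp hq
    exact absurd (hp.trans hq.symm) hpq
  | [x, y], hl =>
    simp only [isLeaf, Bool.or_eq_true] at hl
    simp only [List.mem_cons, List.not_mem_nil, or_false] at hp hq
    rcases hp with rfl | rfl <;> rcases hq with rfl | rfl
    · exact absurd rfl hpq
    · exact hl
    · exact hl.symm
    · exact absurd rfl hpq

theorem isPlasticPair_of_separates {lam : ℝ} (hlam : 1 ≤ lam) {p q : ℕ × ℕ} (hpq : p ≠ q)
    (hp : p.1 < p.2) (hq : q.1 < q.2) (hpr : IsTrinomialRoot lam p.1 p.2)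
    (hqr : IsTrinomialRoot lam q.1 q.2) (k : ℕ) : ∀ (N D : ℕ) (l : List (ℕ × ℕ)),
      0 < D → D < N → separates k N D l = true → p ∈ l → q ∈ l →
        isPlasticPair p q = true ∨ isPlasticPair q p = true := by
  induction k with
  | zero => exact fun N D l _ _ h hpl hql => isPlasticPair_of_isLeaf h hpl hql hpq
  | succ k ih =>
    intro N D l hD hN h hpl hql
    simp only [separates, Bool.or_eq_true, Bool.and_eq_true] at h
    rcases h with h | ⟨h1, h2⟩
    · exact isPlasticPair_of_isLeaf h hpl hql hpq
    · have e : posAt N D p = true ↔ posAt N D q = true :=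
        (hpr.posAt_iff_lt hlam hp hD hN.le).trans (hqr.posAt_iff_lt hlam hq hD hN.le).symm
      by_cases hs : posAt N D p = true
      · exact ih _ _ _ (by omega) (by omega) h1 (List.mem_filter.2 ⟨hpl, hs⟩)
          (List.mem_filter.2 ⟨hql, e.1 hs⟩)
      · have hs' : ¬ posAt N D q = true := fun h => hs (e.2 h)
        exact ih _ _ _ (by omega) (by omega) h2 (List.mem_filter.2 ⟨hpl, by simpa using hs⟩)
          (List.mem_filter.2 ⟨hql, by simpa using hs'⟩)

/-- A trinomial with a root `≥ 1.05` has degree at most `62`. -/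
theorem IsTrinomialRoot.degree_le {lam : ℝ} (hlam : 1.05 ≤ lam) {a b : ℕ} (hab : a < b)
    (h : IsTrinomialRoot lam a b) : b ≤ 62 := by
  by_contra! hb
  have hlam1 : (1 : ℝ) ≤ 1.05 := by norm_num
  obtain ⟨c, rfl⟩ : ∃ c, b = c + 1 := ⟨b - 1, by omega⟩
  have h1 : (1.05 : ℝ) ^ 62 ≤ 1.05 ^ c := pow_le_pow_right₀ hlam1 (by omega)
  have h2 : (1.05 : ℝ) ^ c ≤ lam ^ c := by gcongr
  have h3 : lam ^ a ≤ lam ^ c := pow_le_pow_right₀ (hlam1.trans hlam) (by omega)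
  have h4 : (20 : ℝ) < 1.05 ^ 62 := by norm_num
  unfold IsTrinomialRoot at h
  have h5 : lam ^ c * (lam - 1) ≤ 1 := by rw [pow_succ] at h; linarith
  nlinarith

theorem IsTrinomialRoot.eq_of_lt {lam : ℝ} (hlam : 1.05 ≤ lam) {a₁ b₁ a₂ b₂ : ℕ}
    (h₁ : a₁ < b₁) (h₂ : a₂ < b₂) (h : a₁ < a₂) (hr₁ : IsTrinomialRoot lam a₁ b₁)
    (hr₂ : IsTrinomialRoot lam a₂ b₂) : b₁ = 3 * a₁ ∧ a₂ = 4 * a₁ ∧ b₂ = 5 * a₁ := by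
  have hlam1 : 1 ≤ lam := le_trans (by norm_num) hlam
  have mem : ∀ a b : ℕ, a < b → IsTrinomialRoot lam a b →
      (a, b) ∈ (exponentPairs 63).filter fun p => !posAt 21 20 p := by
    intro a b hab hr
    have hb := hr.degree_le hlam hab
    refine List.mem_filter.2 ⟨mem_exponentPairs.2 ⟨hab, by omega⟩, ?_⟩
    rw [Bool.not_eq_true', ← Bool.not_eq_true,
      hr.posAt_iff_lt hlam1 hab (by norm_num) (by norm_num)]
    norm_num at hlam ⊢
    exact hlam
  have := isPlasticPair_of_separates hlam1 (p := (a₁, b₁)) (q := (a₂, b₂))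
    (by simp only [ne_eq, Prod.mk.injEq]; omega) h₁ h₂ hr₁ hr₂ 20 3 2 _ (by norm_num)
    (by norm_num) separates_exponentPairs (mem a₁ b₁ h₁ hr₁) (mem a₂ b₂ h₂ hr₂)
  simp only [isPlasticPair, Bool.and_eq_true, Nat.beq_eq] at this
  omega

/-! ### The plastic number -/

theorem plastic_pos : 0 < plastic := by
  have h : √69 < 9 := by
    rw [Real.sqrt_lt' (by norm_num)]
    norm_num
  have h' : 0 < 9 - √69 := by linarith
  unfold plastic
  positivity

theorem plastic_cube : plastic ^ 3 = plastic + 1 := by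
  have hs : √69 ^ 2 = 69 := Real.sq_sqrt (by norm_num)
  have h : √69 < 9 := by
    rw [Real.sqrt_lt' (by norm_num)]
    norm_num
  have h' : 0 < 9 - √69 := by linarith
  have cube : ∀ x : ℝ, 0 ≤ x → (x ^ (1 / 3 : ℝ)) ^ 3 = x := fun x hx => by
    rw [← Real.rpow_natCast, ← Real.rpow_mul hx]
    norm_num
  have hu := cube (9 + √69) (by positivity)
  have hv := cube (9 - √69) h'.le
  have hw := cube 18 (by norm_num)
  have hu0 : 0 < (9 + √69) ^ (1 / 3 : ℝ) := by positivity
  have hv0 : 0 < (9 - √69) ^ (1 / 3 : ℝ) := by positivity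
  have hw0 : 0 < (18 : ℝ) ^ (1 / 3 : ℝ) := by positivity
  unfold plastic
  generalize (9 + √69) ^ (1 / 3 : ℝ) = u at *
  generalize (9 - √69) ^ (1 / 3 : ℝ) = v at *
  generalize (18 : ℝ) ^ (1 / 3 : ℝ) = w at *
  have huv : 3 * (u * v) = w ^ 2 := by
    refine (pow_left_inj₀ (by positivity) (by positivity) (three_ne_zero)).1 ?_
    calc (3 * (u * v)) ^ 3 = 27 * (u ^ 3 * v ^ 3) := by ring
      _ = 27 * (81 - √69 ^ 2) := by rw [hu, hv]; ring
      _ = (w ^ 3) ^ 2 := by rw [hs, hw]; norm_num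
      _ = (w ^ 2) ^ 3 := by ring
  have huv3 : (u + v) ^ 3 = w ^ 3 + w ^ 2 * (u + v) := by
    rw [← huv, hw]
    linear_combination hu + hv
  rw [div_pow, huv3]
  field_simp
  ring

theorem one_lt_plastic : 1 < plastic := by
  by_contra! h
  have h3 : plastic ^ 3 ≤ 1 := pow_le_one₀ plastic_pos.le h
  linarith [plastic_cube, plastic_pos]

theorem le_plastic : 1.05 ≤ plastic := by
  by_contra! h
  have h3 : plastic ^ 3 ≤ 1.05 ^ 3 := by
    have := plastic_pos
    gcongr
  have := plastic_cube
  have := one_lt_plastic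
  norm_num at h3
  linarith

theorem isTrinomialRoot_one_three : IsTrinomialRoot plastic 1 3 := by
  unfold IsTrinomialRoot
  linarith [plastic_cube]

theorem isTrinomialRoot_four_five : IsTrinomialRoot plastic 4 5 := by
  unfold IsTrinomialRoot
  linear_combination (-plastic ^ 2 + plastic - 1) * plastic_cube

theorem IsTrinomialRoot.eq_plastic {lam : ℝ} (hlam : 1 ≤ lam) {a b : ℕ}
    (h : IsTrinomialRoot lam a b) (hab : (a, b) = (1, 3) ∨ (a, b) = (4, 5)) : lam = plastic := by
  simp only [Prod.mk.injEq] at hab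
  rcases hab with ⟨rfl, rfl⟩ | ⟨rfl, rfl⟩
  · exact h.unique hlam one_lt_plastic.le (by norm_num) isTrinomialRoot_one_three
  · exact h.unique hlam one_lt_plastic.le (by norm_num) isTrinomialRoot_four_five

theorem isTrinomialRoot_mul {lam : ℝ} {m a b : ℕ} :
    IsTrinomialRoot lam (a * m) (b * m) ↔ IsTrinomialRoot (lam ^ m) a b := by
  unfold IsTrinomialRoot
  rw [← pow_mul, ← pow_mul, mul_comm a, mul_comm b]

/-- The common roots of two distinct trinomials. -/
theorem isTrinomialRoot_and_iff {lam : ℝ} (hlam : 1.05 ≤ lam) {a₁ b₁ a₂ b₂ : ℕ} (h₁ : a₁ < b₁)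
    (h₂ : a₂ < b₂) (h : a₁ < a₂) :
    (IsTrinomialRoot lam a₁ b₁ ∧ IsTrinomialRoot lam a₂ b₂) ↔
      ∃ m : ℕ, 1 ≤ m ∧ m ≤ 5 ∧ lam = plastic ^ (1 / (m : ℝ)) ∧
        a₁ = m ∧ b₁ = 3 * m ∧ a₂ = 4 * m ∧ b₂ = 5 * m := by
  constructor
  · rintro ⟨hr₁, hr₂⟩
    obtain ⟨rfl, rfl, rfl⟩ := hr₁.eq_of_lt hlam h₁ h₂ h hr₂
    have hlam1 : 1 ≤ lam := le_trans (by norm_num) hlam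
    have hm : lam ^ a₁ = plastic := by
      refine IsTrinomialRoot.eq_plastic (one_le_pow₀ hlam1) (a := 1) (b := 3) ?_ (Or.inl rfl)
      rw [← isTrinomialRoot_mul, one_mul]
      exact hr₁
    refine ⟨a₁, by omega, ?_, ?_, rfl, rfl, rfl, rfl⟩
    · by_contra! h5
      have h6 : (1.05 : ℝ) ^ 6 ≤ plastic := by
        rw [← hm]
        calc (1.05 : ℝ) ^ 6 ≤ 1.05 ^ a₁ := pow_le_pow_right₀ (by norm_num) (by omega)
          _ ≤ lam ^ a₁ := by gcongr
      norm_num at h6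
      nlinarith [plastic_cube, mul_self_nonneg plastic]
    · rw [← hm, one_div, Real.pow_rpow_inv_natCast (by linarith) (by omega)]
  · rintro ⟨m, hm, -, rfl, rfl, rfl, rfl, rfl⟩
    have e : (plastic ^ (1 / (a₁ : ℝ))) ^ a₁ = plastic := by
      rw [one_div, Real.rpow_inv_natCast_pow plastic_pos.le (by omega)]
    refine ⟨?_, ?_⟩
    · have := isTrinomialRoot_one_three
      rw [← e, ← isTrinomialRoot_mul, one_mul] at this
      exact this
    · have := isTrinomialRoot_four_five
      rw [← e, ← isTrinomialRoot_mul] at this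
      exact this

/-! ### The triads at unity -/

theorem zpow_mem_lattice (lam : ℝ) (n : ℤ) : lam ^ n ∈ lattice lam := ⟨n, Or.inl rfl⟩

theorem neg_zpow_mem_lattice (lam : ℝ) (n : ℤ) : -lam ^ n ∈ lattice lam := ⟨n, Or.inr rfl⟩

theorem isTrinomialRoot_iff_zpow {lam : ℝ} {a b : ℕ} :
    IsTrinomialRoot lam a b ↔ lam ^ (b : ℤ) = 1 + lam ^ (a : ℤ) := by
  unfold IsTrinomialRoot
  rw [zpow_natCast, zpow_natCast, eq_sub_iff_add_eq, eq_comm]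

/-- Two nodes summing to one come, up to rescaling, from a trinomial. -/
theorem exists_of_zpow_add_zpow_eq_one {lam : ℝ} (hlam : 1 < lam) {i j : ℤ}
    (h : lam ^ i + lam ^ j = 1) (hij : i ≤ j) :
    ∃ a b : ℕ, a < b ∧ IsTrinomialRoot lam a b ∧ i = -b ∧ j = a - b := by
  have h0 : lam ≠ 0 := by positivity
  have hj : j < 0 := (zpow_lt_one_iff_right₀ hlam).1 (by
    have : 0 < lam ^ i := by positivity
    linarith)
  obtain ⟨b, rfl⟩ : ∃ b : ℕ, i = -b := ⟨i.natAbs, by omega⟩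
  obtain ⟨a, rfl⟩ : ∃ a : ℕ, j = a - b := ⟨(j + b).natAbs, by omega⟩
  refine ⟨a, b, by omega, isTrinomialRoot_iff_zpow.2 ?_, rfl, rfl⟩
  have h1 : lam ^ (b : ℤ) * (lam ^ (-(b : ℤ)) + lam ^ ((a : ℤ) - b)) = lam ^ (b : ℤ) * 1 := by
    rw [h]
  rw [mul_add, ← zpow_add₀ h0, ← zpow_add₀ h0] at h1
  simpa using h1.symm

/-- Two nodes differing by one come, up to rescaling, from a trinomial. -/
theorem exists_of_zpow_eq_one_add_zpow {lam : ℝ} (hlam : 1 < lam) {i j : ℤ}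
    (h : lam ^ i = 1 + lam ^ j) :
    ∃ a b : ℕ, a < b ∧ IsTrinomialRoot lam a b ∧
      (i = b ∧ j = a ∨ i = (b : ℤ) - a ∧ j = -a) := by
  have h0 : lam ≠ 0 := by positivity
  have hj0 : 0 < lam ^ j := by positivity
  have hi : 0 < i := (one_lt_zpow_iff_right₀ hlam).1 (by linarith)
  have hij : j < i := (zpow_lt_zpow_iff_right₀ hlam).1 (by linarith)
  rcases le_total 0 j with hj | hj
  · lift j to ℕ using hj
    lift i to ℕ using hi.le
    exact ⟨j, i, by omega, isTrinomialRoot_iff_zpow.2 h, Or.inl ⟨rfl, rfl⟩⟩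
  · obtain ⟨a, rfl⟩ : ∃ a : ℕ, j = -a := ⟨j.natAbs, by omega⟩
    obtain ⟨b, rfl⟩ : ∃ b : ℕ, i = b - a := ⟨(i + a).natAbs, by omega⟩
    refine ⟨a, b, by omega, isTrinomialRoot_iff_zpow.2 ?_, Or.inr ⟨rfl, rfl⟩⟩
    have h1 : lam ^ (a : ℤ) * lam ^ ((b : ℤ) - a) = lam ^ (a : ℤ) * (1 + lam ^ (-(a : ℤ))) := by
      rw [h]
    rw [mul_add, ← zpow_add₀ h0, ← zpow_add₀ h0] at h1
    simpa [add_comm] using h1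

theorem tableGeneral_subset {lam : ℝ} (hlam : 1 < lam) {a b : ℕ} (h : IsTrinomialRoot lam a b) :
    tableGeneral lam a b ⊆ triadsAtUnity lam := by
  have h0 : lam ≠ 0 := by positivity
  rw [isTrinomialRoot_iff_zpow] at h
  have one_mem : (1 : ℝ) ∈ lattice lam := by simpa using zpow_mem_lattice lam 0
  have e1 : 1 = lam ^ (b : ℤ) + -lam ^ (a : ℤ) := by linarith
  have e2 : 1 = lam ^ ((b : ℤ) - a) + -lam ^ (-(a : ℤ)) := by
    rw [sub_eq_add_neg, zpow_add₀ h0, h, add_mul, ← zpow_add₀ h0]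
    simp
  have e3 : 1 = lam ^ (-(b : ℤ)) + lam ^ ((a : ℤ) - b) := by
    rw [sub_eq_add_neg, zpow_add₀ h0, ← one_add_mul, ← h, ← zpow_add₀ h0]
    simp
  rintro pq hpq
  simp only [tableGeneral, Set.mem_insert_iff, Set.mem_singleton_iff] at hpq
  rcases hpq with rfl | rfl | rfl | rfl | rfl | rfl
  · exact ⟨one_mem, zpow_mem_lattice _ _, neg_zpow_mem_lattice _ _, e1⟩
  · exact ⟨one_mem, neg_zpow_mem_lattice _ _, zpow_mem_lattice _ _, e1.trans (add_comm _ _)⟩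
  · exact ⟨one_mem, zpow_mem_lattice _ _, neg_zpow_mem_lattice _ _, e2⟩
  · exact ⟨one_mem, neg_zpow_mem_lattice _ _, zpow_mem_lattice _ _, e2.trans (add_comm _ _)⟩
  · exact ⟨one_mem, zpow_mem_lattice _ _, zpow_mem_lattice _ _, e3⟩
  · exact ⟨one_mem, zpow_mem_lattice _ _, zpow_mem_lattice _ _, e3.trans (add_comm _ _)⟩

/-- Every triad at unity belongs to the table of some trinomial. -/
theorem mem_triadsAtUnity_iff {lam : ℝ} (hlam : 1 < lam) {pq : ℝ × ℝ} :
    pq ∈ triadsAtUnity lam ↔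
      ∃ a b : ℕ, a < b ∧ IsTrinomialRoot lam a b ∧ pq ∈ tableGeneral lam a b := by
  constructor
  · obtain ⟨p, q⟩ := pq
    rintro ⟨-, ⟨i, hi⟩, ⟨j, hj⟩, h⟩
    dsimp only at hi hj h
    have hi0 : 0 < lam ^ i := by positivity
    have hj0 : 0 < lam ^ j := by positivity
    rcases hi with rfl | rfl <;> rcases hj with rfl | rfl
    · rcases le_total i j with hij | hij
      · obtain ⟨a, b, hab, hr, rfl, rfl⟩ := exists_of_zpow_add_zpow_eq_one hlam h.symm hij
        exact ⟨a, b, hab, hr, by simp [tableGeneral]⟩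
      · rw [add_comm] at h
        obtain ⟨a, b, hab, hr, rfl, rfl⟩ := exists_of_zpow_add_zpow_eq_one hlam h.symm hij
        exact ⟨a, b, hab, hr, by simp [tableGeneral]⟩
    · obtain ⟨a, b, hab, hr, ⟨rfl, rfl⟩ | ⟨rfl, rfl⟩⟩ :=
        exists_of_zpow_eq_one_add_zpow hlam (i := i) (j := j) (by linarith)
      · exact ⟨a, b, hab, hr, by simp [tableGeneral]⟩
      · exact ⟨a, b, hab, hr, by simp [tableGeneral]⟩
    · obtain ⟨a, b, hab, hr, ⟨rfl, rfl⟩ | ⟨rfl, rfl⟩⟩ :=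
        exists_of_zpow_eq_one_add_zpow hlam (i := j) (j := i) (by linarith)
      · exact ⟨a, b, hab, hr, by simp [tableGeneral]⟩
      · exact ⟨a, b, hab, hr, by simp [tableGeneral]⟩
    · linarith
  · rintro ⟨a, b, -, hr, h⟩
    exact tableGeneral_subset hlam hr h

theorem IsTrinomialRoot.right_unique {lam : ℝ} (hlam : 1 < lam) {a b b' : ℕ}
    (h : IsTrinomialRoot lam a b) (h' : IsTrinomialRoot lam a b') : b = b' := by
  unfold IsTrinomialRoot at h h'
  exact pow_right_injective₀ (by linarith) hlam.ne' (by linarith : lam ^ b = lam ^ b')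

theorem one_lt_of_le {lam : ℝ} (hlam : 1.05 ≤ lam) : 1 < lam := lt_of_lt_of_le (by norm_num) hlam

theorem GenericPair.unique {lam : ℝ} (hlam : 1.05 ≤ lam) {a b a' b' : ℕ} (hg : GenericPair a b)
    (h : IsTrinomialRoot lam a b) (hab' : a' < b') (h' : IsTrinomialRoot lam a' b') :
    a' = a ∧ b' = b := by
  obtain ⟨ha, hab, -, hc, h13, h45⟩ := hg
  simp only [ne_eq, Prod.mk.injEq] at h13 h45
  rcases lt_trichotomy a a' with hlt | rfl | hlt
  · obtain ⟨rfl, -, -⟩ := h.eq_of_lt hlam hab hab' hlt h'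
    have : a = 1 := hc.eq_one_of_dvd (dvd_mul_left a 3)
    omega
  · exact ⟨rfl, h'.right_unique (one_lt_of_le hlam) h⟩
  · obtain ⟨-, rfl, rfl⟩ := h'.eq_of_lt hlam hab' hab hlt h
    have : a' = 1 := Nat.dvd_one.1 (hc ▸ Nat.dvd_gcd (dvd_mul_left a' 4) (dvd_mul_left a' 5))
    omega

theorem triadsAtUnity_eq_tableGeneral {lam : ℝ} (hlam : 1 < lam) {a b : ℕ} (hab : a < b)
    (h : IsTrinomialRoot lam a b)
    (huniq : ∀ a' b' : ℕ, a' < b' → IsTrinomialRoot lam a' b' → a' = a ∧ b' = b) :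
    triadsAtUnity lam = tableGeneral lam a b := by
  ext pq
  rw [mem_triadsAtUnity_iff hlam]
  constructor
  · rintro ⟨a', b', hab', hr, hpq⟩
    obtain ⟨rfl, rfl⟩ := huniq a' b' hab' hr
    exact hpq
  · exact fun hpq => ⟨a, b, hab, h, hpq⟩

theorem isTrinomialRoot_two : IsTrinomialRoot 2 0 1 := by
  norm_num [IsTrinomialRoot]

theorem triadsAtUnity_two : triadsAtUnity 2 = tableTwo := by
  rw [triadsAtUnity_eq_tableGeneral (by norm_num) zero_lt_one isTrinomialRoot_two]
  · ext pq
    simp only [tableGeneral, tableTwo, Set.mem_insert_iff, Set.mem_singleton_iff]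
    norm_num
    tauto
  · intro a b hab h
    rcases Nat.eq_zero_or_pos a with rfl | ha
    · exact ⟨rfl, h.right_unique (by norm_num) isTrinomialRoot_two⟩
    · have := isTrinomialRoot_two.eq_of_lt (by norm_num) zero_lt_one hab ha h
      omega

theorem ncard_tableTwo : tableTwo.ncard = 3 := by
  unfold tableTwo
  rw [Set.ncard_insert_of_notMem, Set.ncard_pair] <;> norm_num

theorem triadsAtUnity_plastic : triadsAtUnity plastic = tableExtended plastic := by
  have key : ∀ pq, pq ∈ triadsAtUnity plastic ↔
      pq ∈ tableGeneral plastic (1 : ℕ) (3 : ℕ) ∨ pq ∈ tableGeneral plastic (4 : ℕ) (5 : ℕ) := by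
    intro pq
    rw [mem_triadsAtUnity_iff one_lt_plastic]
    constructor
    · rintro ⟨a, b, hab, hr, hpq⟩
      rcases lt_trichotomy a 1 with ha | rfl | ha
      · have := hr.eq_of_lt le_plastic hab (by norm_num) ha isTrinomialRoot_one_three
        omega
      · obtain rfl := hr.right_unique one_lt_plastic isTrinomialRoot_one_three
        exact Or.inl hpq
      · obtain ⟨-, rfl, rfl⟩ :=
          isTrinomialRoot_one_three.eq_of_lt le_plastic (by norm_num) hab ha hr
        exact Or.inr hpq
    · rintro (h | h)
      · exact ⟨1, 3, by norm_num, isTrinomialRoot_one_three, h⟩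
      · exact ⟨4, 5, by norm_num, isTrinomialRoot_four_five, h⟩
  ext pq
  rw [key]
  simp only [tableGeneral, tableExtended, Set.mem_insert_iff, Set.mem_singleton_iff]
  simp only [Nat.cast_one, Nat.cast_ofNat, show (3 : ℤ) - 1 = 2 from rfl,
    show (1 : ℤ) - 3 = -2 from rfl, show (5 : ℤ) - 4 = 1 from rfl,
    show (4 : ℤ) - 5 = -1 from rfl, zpow_ofNat, pow_one, or_assoc]

/-- A node on the lattice, given by its sign and exponent. -/
noncomputable def node (lam : ℝ) (x : Bool × ℤ) : ℝ := if x.1 then lam ^ x.2 else -lam ^ x.2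

theorem node_injective {lam : ℝ} (hlam : 1 < lam) : Function.Injective (node lam) := by
  rintro ⟨s, i⟩ ⟨t, j⟩ h
  have hi : 0 < lam ^ i := by positivity
  have hj : 0 < lam ^ j := by positivity
  cases s <;> cases t <;> simp only [node, if_true, Bool.false_eq_true, if_false, neg_inj] at h
  · rw [zpow_right_injective₀ (by positivity) hlam.ne' h]
  · linarith
  · linarith
  · rw [zpow_right_injective₀ (by positivity) hlam.ne' h]

theorem ncard_image_nodes {lam : ℝ} (hlam : 1 < lam) (s : Finset ((Bool × ℤ) × (Bool × ℤ))) :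
    (Set.image (Prod.map (node lam) (node lam)) (s : Set ((Bool × ℤ) × (Bool × ℤ)))).ncard =
      s.card := by
  rw [Set.ncard_image_of_injective _ ((node_injective hlam).prodMap (node_injective hlam)),
    Set.ncard_coe_finset]

theorem ncard_tableGeneral {lam : ℝ} (hlam : 1 < lam) {a b : ℤ} (ha : 0 < a) :
    (tableGeneral lam a b).ncard = 6 := by
  have e : tableGeneral lam a b = Set.image (Prod.map (node lam) (node lam))
      (({((true, b), (false, a)), ((false, a), (true, b)),
        ((true, b - a), (false, -a)), ((false, -a), (true, b - a)),
        ((true, -b), (true, a - b)), ((true, a - b), (true, -b))} :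
        Finset ((Bool × ℤ) × (Bool × ℤ))) : Set ((Bool × ℤ) × (Bool × ℤ))) := by
    simp [tableGeneral, node, Set.image_insert_eq]
  rw [e, ncard_image_nodes hlam]
  repeat rw [Finset.card_insert_of_notMem
    (by simp only [Finset.mem_insert, Finset.mem_singleton, Prod.mk.injEq]; grind)]
  rw [Finset.card_singleton]

theorem ncard_tableExtended {s : ℝ} (hs : 1 < s) : (tableExtended s).ncard = 12 := by
  have e : tableExtended s = Set.image (Prod.map (node s) (node s))
      (({((true, 3), (false, 1)), ((false, 1), (true, 3)),
        ((true, 2), (false, -1)), ((false, -1), (true, 2)),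
        ((true, -3), (true, -2)), ((true, -2), (true, -3)),
        ((true, 5), (false, 4)), ((false, 4), (true, 5)),
        ((true, 1), (false, -4)), ((false, -4), (true, 1)),
        ((true, -5), (true, -1)), ((true, -1), (true, -5))} :
        Finset ((Bool × ℤ) × (Bool × ℤ))) : Set ((Bool × ℤ) × (Bool × ℤ))) := by
    simp only [tableExtended, Finset.coe_insert, Finset.coe_singleton, Set.image_insert_eq,
      Set.image_singleton, Prod.map_apply, node, if_true, Bool.false_eq_true, if_false, zpow_ofNat,
      pow_one]
  rw [e, ncard_image_nodes hs]
  decide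

/-! ### Nondegenerate lattices -/

theorem neg_mem_lattice {lam x : ℝ} (hx : x ∈ lattice lam) : -x ∈ lattice lam := by
  obtain ⟨n, rfl | rfl⟩ := hx
  · exact neg_zpow_mem_lattice _ _
  · rw [neg_neg]
    exact zpow_mem_lattice _ _

theorem mul_mem_lattice {lam x y : ℝ} (hlam : lam ≠ 0) (hx : x ∈ lattice lam)
    (hy : y ∈ lattice lam) : x * y ∈ lattice lam := by
  obtain ⟨m, rfl | rfl⟩ := hx <;> obtain ⟨n, rfl | rfl⟩ := hy <;> refine ⟨m + n, ?_⟩ <;>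
    simp [zpow_add₀ hlam]

theorem inv_mem_lattice {lam x : ℝ} (hx : x ∈ lattice lam) : x⁻¹ ∈ lattice lam := by
  obtain ⟨m, rfl | rfl⟩ := hx <;> refine ⟨-m, ?_⟩ <;> simp

theorem Interacts.symm {lam k p : ℝ} (h : Interacts lam k p) : Interacts lam p k := by
  obtain ⟨q, hk, hp, hq, h⟩ := h
  exact ⟨-q, hp, hk, neg_mem_lattice hq, by linarith⟩

theorem reflTransGen_interacts_symm {lam k p : ℝ}
    (h : Relation.ReflTransGen (Interacts lam) k p) :
    Relation.ReflTransGen (Interacts lam) p k := by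
  induction h with
  | refl => exact .refl
  | tail _ h ih => exact .head h.symm ih

/-- The units by which every node can be multiplied without leaving its component. -/
def componentSubgroup (lam : ℝ) (hlam : lam ≠ 0) : Subgroup ℝˣ where
  carrier := {u | (u : ℝ) ∈ lattice lam ∧
    ∀ k ∈ lattice lam, Relation.ReflTransGen (Interacts lam) k (k * u)}
  one_mem' := ⟨by simpa using zpow_mem_lattice lam 0, fun k _ => by simpa using .refl⟩
  mul_mem' := by
    rintro u v ⟨hu, hu'⟩ ⟨hv, hv'⟩
    refine ⟨by simpa using mul_mem_lattice hlam hu hv, fun k hk => (hu' k hk).trans ?_⟩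
    simpa [mul_assoc] using hv' _ (mul_mem_lattice hlam hk hu)
  inv_mem' := by
    rintro u ⟨hu, hu'⟩
    have hi : ((u⁻¹ : ℝˣ) : ℝ) ∈ lattice lam := by simpa using inv_mem_lattice hu
    refine ⟨hi, fun k hk => ?_⟩
    have := reflTransGen_interacts_symm (hu' _ (mul_mem_lattice hlam hk hi))
    rwa [mul_assoc, Units.inv_mul, mul_one] at this

theorem mem_componentSubgroup_of_triad {lam : ℝ} (hlam : lam ≠ 0) {u : ℝˣ} {q : ℝ}
    (h : ((u : ℝ), q) ∈ triadsAtUnity lam) : u ∈ componentSubgroup lam hlam := by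
  obtain ⟨-, hu, hq, h⟩ := h
  dsimp only at hu hq h
  refine ⟨hu, fun k hk => .single ⟨k * q, hk, mul_mem_lattice hlam hk hu,
    mul_mem_lattice hlam hk hq, ?_⟩⟩
  rw [← mul_add, ← h, mul_one]

theorem nondegenerate_of_coprime {lam : ℝ} (hlam : 1 < lam) {a b : ℕ}
    (hc : Nat.Coprime a b) (h : IsTrinomialRoot lam a b) : Nondegenerate lam := by
  have h0 : lam ≠ 0 := by positivity
  set H := componentSubgroup lam h0
  set u : ℝˣ := Units.mk0 lam h0 with hu
  have hz : ∀ n : ℤ, ((u ^ n : ℝˣ) : ℝ) = lam ^ n := fun n => by simp [hu]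
  have hsub := tableGeneral_subset hlam h
  have hb : u ^ (b : ℤ) ∈ H := mem_componentSubgroup_of_triad h0 (q := -lam ^ (a : ℤ))
    (hsub (by simp [tableGeneral, hu]))
  have hab : u ^ ((a : ℤ) - b) ∈ H := mem_componentSubgroup_of_triad h0 (q := lam ^ (-(b : ℤ)))
    (hsub (by simp [tableGeneral, hz]))
  have hna : -u ^ (a : ℤ) ∈ H := mem_componentSubgroup_of_triad h0 (q := lam ^ (b : ℤ))
    (hsub (by simp [tableGeneral, hu]))
  have ha : u ^ (a : ℤ) ∈ H := by
    have := H.mul_mem hab hb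
    rwa [← zpow_add, sub_add_cancel] at this
  have hneg : (-1 : ℝˣ) ∈ H := by
    have := H.mul_mem hna (H.inv_mem ha)
    rwa [neg_mul, mul_inv_cancel] at this
  have hone : u ∈ H := by
    have hg : (1 : ℤ) = a * Nat.gcdA a b + b * Nat.gcdB a b := by
      rw [← Nat.gcd_eq_gcd_ab, hc.gcd_eq_one, Nat.cast_one]
    have := H.mul_mem (H.zpow_mem ha (Nat.gcdA a b)) (H.zpow_mem hb (Nat.gcdB a b))
    rwa [← zpow_mul, ← zpow_mul, ← zpow_add, ← hg, zpow_one] at this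
  have hall : ∀ x ∈ lattice lam, Relation.ReflTransGen (Interacts lam) 1 x := by
    have h1 : (1 : ℝ) ∈ lattice lam := by simpa using zpow_mem_lattice lam 0
    rintro x ⟨n, rfl | rfl⟩
    · simpa [hz] using (H.zpow_mem hone n).2 1 h1
    · simpa [hz] using (H.mul_mem hneg (H.zpow_mem hone n)).2 1 h1
  exact fun k hk p hp => (reflTransGen_interacts_symm (hall k hk)).trans (hall p hp)

/-- Interacting nodes have exponents congruent modulo any common divisor of all trinomial
exponents. -/
theorem Interacts.exists_dvd {lam : ℝ} (hlam : 1 < lam) {d : ℤ}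
    (hd : ∀ a b : ℕ, a < b → IsTrinomialRoot lam a b → d ∣ a ∧ d ∣ b) {k p : ℝ}
    (h : Interacts lam k p) (hk : ∃ n : ℤ, d ∣ n ∧ (k = lam ^ n ∨ k = -lam ^ n)) :
    ∃ n : ℤ, d ∣ n ∧ (p = lam ^ n ∨ p = -lam ^ n) := by
  have h0 : lam ≠ 0 := by positivity
  obtain ⟨q, hkl, hp, hq, h⟩ := h
  obtain ⟨n, hn, hkn⟩ := hk
  have hk0 : k ≠ 0 := by
    have : lam ^ n ≠ 0 := by positivity
    rcases hkn with rfl | rfl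
    · exact this
    · exact neg_ne_zero.2 this
  have hmem : (k⁻¹ * p, k⁻¹ * q) ∈ triadsAtUnity lam := by
    refine ⟨by simpa using zpow_mem_lattice lam 0, mul_mem_lattice h0 (inv_mem_lattice hkl) hp,
      mul_mem_lattice h0 (inv_mem_lattice hkl) hq, ?_⟩
    dsimp only
    rw [← mul_add, ← h, inv_mul_cancel₀ hk0]
  obtain ⟨a, b, hab, hr, hpq⟩ := (mem_triadsAtUnity_iff hlam).1 hmem
  obtain ⟨hda, hdb⟩ := hd a b hab hr
  have hm : ∃ m : ℤ, d ∣ m ∧ (k⁻¹ * p = lam ^ m ∨ k⁻¹ * p = -lam ^ m) := by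
    simp only [tableGeneral, Set.mem_insert_iff, Set.mem_singleton_iff, Prod.mk.injEq] at hpq
    rcases hpq with h | h | h | h | h | h
    · exact ⟨_, hdb, Or.inl h.1⟩
    · exact ⟨_, hda, Or.inr h.1⟩
    · exact ⟨_, dvd_sub hdb hda, Or.inl h.1⟩
    · exact ⟨_, (dvd_neg.2 hda), Or.inr h.1⟩
    · exact ⟨_, (dvd_neg.2 hdb), Or.inl h.1⟩
    · exact ⟨_, dvd_sub hda hdb, Or.inl h.1⟩
  obtain ⟨m, hm, hpm⟩ := hm
  have hp' : p = k * (k⁻¹ * p) := by rw [mul_inv_cancel_left₀ hk0]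
  refine ⟨n + m, dvd_add hn hm, ?_⟩
  rw [hp', zpow_add₀ h0]
  rcases hkn with hkn | hkn <;> rcases hpm with hpm | hpm <;> rw [hpm, hkn] <;> simp

theorem Nondegenerate.isUnit_of_dvd {lam : ℝ} (hlam : 1 < lam) (h : Nondegenerate lam) {d : ℤ}
    (hd : ∀ a b : ℕ, a < b → IsTrinomialRoot lam a b → d ∣ a ∧ d ∣ b) : d ∣ 1 := by
  have h0 : lam ≠ 0 := by positivity
  have hr := h 1 (by simpa using zpow_mem_lattice lam 0) lam
    (by simpa using zpow_mem_lattice lam 1)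
  have key : ∀ x, Relation.ReflTransGen (Interacts lam) 1 x →
      ∃ n : ℤ, d ∣ n ∧ (x = lam ^ n ∨ x = -lam ^ n) := by
    intro x hx
    induction hx with
    | refl => exact ⟨0, dvd_zero d, Or.inl (zpow_zero lam).symm⟩
    | tail _ hi ih => exact hi.exists_dvd hlam hd ih
  obtain ⟨n, hn, hl | hl⟩ := key lam hr
  · have : (1 : ℤ) = n := zpow_right_injective₀ (by positivity) hlam.ne' (by simpa using hl)
    rwa [this]
  · have : 0 < lam ^ n := by positivity
    linarith

theorem Nondegenerate.exists_coprime {lam : ℝ} (hlam : 1.05 ≤ lam) (h : Nondegenerate lam) :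
    ∃ a b : ℕ, a < b ∧ Nat.Coprime a b ∧ IsTrinomialRoot lam a b := by
  have hlam1 := one_lt_of_le hlam
  by_cases hex : ∃ a b : ℕ, a < b ∧ IsTrinomialRoot lam a b
  · obtain ⟨a, b, hab, hr⟩ := hex
    refine ⟨a, b, hab, ?_, hr⟩
    have : ((Nat.gcd a b : ℕ) : ℤ) ∣ 1 := by
      refine h.isUnit_of_dvd hlam1 fun a' b' hab' hr' => ?_
      simp only [Int.natCast_dvd_natCast]
      rcases lt_trichotomy a a' with hlt | rfl | hlt
      · obtain ⟨rfl, rfl, rfl⟩ := hr.eq_of_lt hlam hab hab' hlt hr'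
        simp
      · obtain rfl := hr.right_unique hlam1 hr'
        exact ⟨Nat.gcd_dvd_left _ _, Nat.gcd_dvd_right _ _⟩
      · obtain ⟨rfl, rfl, rfl⟩ := hr'.eq_of_lt hlam hab' hab hlt hr
        simp [Nat.gcd_mul_right]
    exact Nat.dvd_one.1 (by exact_mod_cast this)
  · push Not at hex
    have := h.isUnit_of_dvd hlam1 (d := 0) fun a b hab hr => absurd hr (hex a b hab)
    simp at this

theorem nondegenerate_iff {lam : ℝ} (hlam : 1.05 ≤ lam) :
    Nondegenerate lam ↔ lam = 2 ∨ lam = plastic ∨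
      ∃ a b : ℕ, GenericPair a b ∧ IsTrinomialRoot lam a b := by
  have hlam1 := one_lt_of_le hlam
  constructor
  · intro h
    obtain ⟨a, b, hab, hc, hr⟩ := h.exists_coprime hlam
    rcases Nat.eq_zero_or_pos a with rfl | ha
    · obtain rfl : b = 1 := by simpa using hc
      exact Or.inl (hr.unique hlam1.le (by norm_num) hab isTrinomialRoot_two)
    · by_cases hpl : (a, b) = (1, 3) ∨ (a, b) = (4, 5)
      · exact Or.inr (Or.inl (hr.eq_plastic hlam1.le hpl))
      · rw [not_or] at hpl
        exact Or.inr (Or.inr ⟨a, b, ⟨ha, hab, hr.degree_le hlam hab, hc, hpl.1, hpl.2⟩, hr⟩)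
  · rintro (rfl | rfl | ⟨a, b, hg, hr⟩)
    · exact nondegenerate_of_coprime hlam1 (by norm_num) isTrinomialRoot_two
    · exact nondegenerate_of_coprime hlam1 (by norm_num) isTrinomialRoot_one_three
    · exact nondegenerate_of_coprime hlam1 hg.2.2.2.1 hr

theorem triadsAtUnity_generic {lam : ℝ} (hlam : 1.05 ≤ lam) {a b : ℕ} (hg : GenericPair a b)
    (h : IsTrinomialRoot lam a b) :
    triadsAtUnity lam = tableGeneral lam a b ∧ (triadsAtUnity lam).ncard = 6 := by
  have e := triadsAtUnity_eq_tableGeneral (one_lt_of_le hlam) hg.2.1 h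
    fun a' b' hab' hr' => hg.unique hlam h hab' hr'
  refine ⟨e, ?_⟩
  rw [e]
  exact ncard_tableGeneral (one_lt_of_le hlam) (by exact_mod_cast hg.1)

end LogLattice

/-- Classification of the nondegenerate logarithmic lattices with spacing factor `≥ 1.05`,
all their triads at unity, and the common roots `≥ 1.05` of two trinomials. -/
theorem theorem1 :
    -- the nondegenerate lattices
    (∀ lam : ℝ, 1.05 ≤ lam →
      (LogLattice.Nondegenerate lam ↔
        lam = 2 ∨ lam = LogLattice.plastic ∨
          ∃ a b : ℕ, LogLattice.GenericPair a b ∧ LogLattice.IsTrinomialRoot lam a b)) ∧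
    -- their triads at unity
    (LogLattice.triadsAtUnity 2 = LogLattice.tableTwo ∧
      (LogLattice.triadsAtUnity 2).ncard = 3) ∧
    (LogLattice.triadsAtUnity LogLattice.plastic =
        LogLattice.tableExtended LogLattice.plastic ∧
      (LogLattice.triadsAtUnity LogLattice.plastic).ncard = 12) ∧
    (∀ lam : ℝ, 1.05 ≤ lam → ∀ a b : ℕ,
      LogLattice.GenericPair a b → LogLattice.IsTrinomialRoot lam a b →
        LogLattice.triadsAtUnity lam = LogLattice.tableGeneral lam a b ∧
        (LogLattice.triadsAtUnity lam).ncard = 6) ∧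
    -- common roots of two distinct trinomials
    (∀ lam : ℝ, 1.05 ≤ lam → ∀ a₁ b₁ a₂ b₂ : ℕ, a₁ < b₁ → a₂ < b₂ → a₁ < a₂ →
      ((LogLattice.IsTrinomialRoot lam a₁ b₁ ∧ LogLattice.IsTrinomialRoot lam a₂ b₂) ↔
        ∃ m : ℕ, 1 ≤ m ∧ m ≤ 5 ∧ lam = LogLattice.plastic ^ (1 / (m : ℝ)) ∧
          a₁ = m ∧ b₁ = 3 * m ∧ a₂ = 4 * m ∧ b₂ = 5 * m)) := by
  refine ⟨fun lam hlam => LogLattice.nondegenerate_iff hlam,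
    ⟨LogLattice.triadsAtUnity_two, ?_⟩, ⟨LogLattice.triadsAtUnity_plastic, ?_⟩,
    fun lam hlam a b hg h => LogLattice.triadsAtUnity_generic hlam hg h,
    fun lam hlam a₁ b₁ a₂ b₂ h₁ h₂ h => LogLattice.isTrinomialRoot_and_iff hlam h₁ h₂ h⟩
  · rw [LogLattice.triadsAtUnity_two, LogLattice.ncard_tableTwo]
  · rw [LogLattice.triadsAtUnity_plastic,
      LogLattice.ncard_tableExtended LogLattice.one_lt_plastic]
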